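/- **Pumping Lemma.** Let $\mathbb F$ be a field, $\Sigma,\Delta$ ranked alphabets, $\mathcal A=(Q,\Sigma,F,R,\mathrm{wt})$ a weighted tree automaton over $\mathbb F$ (finitely many states, rules $\sigma(q_1,\dots,q_k)\to q$ with weights in $\mathbb F$), and $h\colon T_\Sigma\to T_\Delta$ a tree homomorphism, given by trees $h(\sigma)\in T_\Delta(\{x_1,\dots,x_k\})$ for $\sigma\in\Sigma_k$. Assume that $h$ is *tetris-free*: every $x_1,\dots,x_k$ occurs in $h(\sigma)$ for $\sigma\in\Sigma_k$, no $h(\sigma)$ is a variable, and $h(s)=h(s')$ implies that $s,s'$ have the same positions and $h(s(p))=h(s'(p))$ (as trees over $\Delta$ and the variables) at every position $p$. Let $\mathcal A'$ be the standard weighted tree automaton with equality constraints for $h([\![\mathcal A]\!])$. Its states are $Q\cup\{\bot\}$ with a new sink state $\bot$, its final states are $F$. A rule $r=\sigma(q_1,\dots,q_k)\to q$ of $\mathcal A$ has as its image the rule $\ell\xrightarrow{E}q$ of $\mathcal A'$, where $\ell$ is obtained from $h(\sigma)$ by replacing, for each $i$, the lexicographically first occurrence of $x_i$ by $q_i$ and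 all others by $\bot$, and $E$ is the equivalence relation on the state positions of $\ell$ that relates two positions if they carry the same variable in $h(\sigma)$; the weight of a rule of this form is the sum of the weights of all rules $r$ of $\mathcal A$ with this image. In addition $\mathcal A'$ has the rules $\delta(\bot,\dots,\bot)\to\bot$, $\delta\in\Delta$, with weight $1$ and trivial $E$. A run on $t\in T_\Delta$ decomposes $t$ into left-hand sides of rules so that states match and, whenever a rule $\ell\xrightarrow{E}q$ is applied at a position $p$, $t|_{pw}=t|_{pw'}$ for all $(w,w')\in E$. Its weight is the product of the weights of its rules, and $[\![\mathcal A']\!](t)$ is the sum of the weights of all runs on $t$ to final states. For a run $\varrho$ on $t$, let $\sim_\varrho$ be the equivalence relation on the positions of $t$ generated by $pwu\sim_\varrho pw'u$ for all $p,w,w',u$ such that $\varrho$ applies a rule $\ell\xrightarrow{E}q$ at $p$ and $(w,w')\in E$. A *class of mutually constrained positions* of $\varrho$ is the $\sim_\varrho$-class of a position $pw$, where $\varrho$ applies at $p$ a rule $\ell\xrightarrow{E}q$ with $q\ne\bot$, and $w$ is a position of $\ell$ labelled by a state. Then there is $N\in\mathbb N$ such that the following holds for every multi-context $C$ (a tree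 over $\Delta$ and a nullary symbol $\Box$ that occurs at least once) and every $t_0\in T_\Delta$ of height at least $N$. Write $C[t]$ for the tree obtained by putting $t$ into every hole $\Box$ of $C$. If $[\![\mathcal A']\!](C[t_0])\ne0$, and the set of positions of the holes of $C$ is a class of mutually constrained positions of some run of $\mathcal A'$ on $C[t_0]$, then there are infinitely many pairwise distinct trees $t_1,t_2,\ldots\in T_\Delta$ with $[\![\mathcal A']\!](C[t_i])\neq0$ for all $i$. -/

import Mathlib

/-! # Ranked trees -/

/-- `RTree rk Z` is the set `T_Σ(Z)` of trees over the ranked alphabet `(S, rk)` whose leaves may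
also be labelled by elements of `Z`. The set `T_Σ` is `RTree rk Empty`. -/
inductive RTree {S : Type*} (rk : S → ℕ) (Z : Type*) where
  | var (z : Z) : RTree rk Z
  | node (σ : S) (ts : Fin (rk σ) → RTree rk Z) : RTree rk Z

namespace RTree

variable {S : Type*} {rk : S → ℕ} {Z W : Type*}

/-- The subtree `t|_p`; it is `none` if `p` is not a position of `t`.
The children of a node are numbered from `0`. -/
def subtreeAt : RTree rk Z → List ℕ → Option (RTree rk Z)
  | t, [] => some t
  | .var _, _ :: _ => none
  | .node σ ts, i :: p => if hi : i < rk σ then (ts ⟨i, hi⟩).subtreeAt p else none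

/-- The set `pos(t)` of positions of `t`. -/
def pos (t : RTree rk Z) : Set (List ℕ) := {p | (t.subtreeAt p).isSome}

/-- The set `pos_z(t)` of the positions of `t` labelled by `z ∈ Z`. -/
def posOf (t : RTree rk Z) (z : Z) : Set (List ℕ) := {p | t.subtreeAt p = some (.var z)}

/-- The set `pos_Z(t)` of the positions of `t` labelled by elements of `Z`. -/
def posVar (t : RTree rk Z) : Set (List ℕ) := {p | ∃ z, p ∈ t.posOf z}

/-- `t.HasSymbol p σ`: the label `t(p)` is the symbol `σ`. -/
def HasSymbol (t : RTree rk Z) (p : List ℕ) (σ : S) : Prop :=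
  ∃ ts, t.subtreeAt p = some (.node σ ts)

/-- The height of a tree: the maximal length of a position. -/
def height : RTree rk Z → ℕ
  | .var _ => 0
  | .node _ ts => Finset.univ.sup fun i => (ts i).height + 1

/-- The substitution `tθ`. -/
def subst : RTree rk Z → (Z → RTree rk W) → RTree rk W
  | .var z, θ => θ z
  | .node σ ts, θ => .node σ fun i => (ts i).subst θ

/-- Change the labels from `Z`, where the new label may depend on the position. -/
def relabel : RTree rk Z → (List ℕ → Z → W) → RTree rk W
  | .var z, f => .var (f [] z)
  | .node σ ts, f => .node σ fun i => (ts i).relabel fun p z => f ((i : ℕ) :: p) z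

/-- The `Z`-labelled leaves of `t`, as a type; `addr` and `label` give their positions and
labels. -/
def Occ : RTree rk Z → Type
  | .var _ => Unit
  | .node σ ts => Σ i : Fin (rk σ), (ts i).Occ

/-- The position of a `Z`-labelled leaf. -/
def addr : (t : RTree rk Z) → t.Occ → List ℕ
  | .var _, _ => []
  | .node _ ts, ⟨i, o⟩ => (i : ℕ) :: (ts i).addr o

/-- The label of a `Z`-labelled leaf. -/
def label : (t : RTree rk Z) → t.Occ → Z
  | .var z, _ => z
  | .node _ ts, ⟨i, o⟩ => (ts i).label o

/-- `t[θ(p₁)]_{p₁} ⋯ [θ(pₙ)]_{pₙ}` where `p₁, …, pₙ` are the `Z`-labelled leaves of `t`. -/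
def plug : (t : RTree rk Z) → (t.Occ → RTree rk W) → RTree rk W
  | .var _, θ => θ ()
  | .node σ ts, θ => .node σ fun i => (ts i).plug fun o => θ ⟨i, o⟩

instance instFintypeOcc : (t : RTree rk Z) → Fintype t.Occ
  | .var _ => inferInstanceAs (Fintype Unit)
  | .node σ ts =>
    letI : ∀ i, Fintype (ts i).Occ := fun i => instFintypeOcc (ts i)
    inferInstanceAs (Fintype (Σ i : Fin (rk σ), (ts i).Occ))

theorem mem_posOf_iff (t : RTree rk Z) (p : List ℕ) (z : Z) :
    p ∈ t.posOf z ↔ ∃ o : t.Occ, t.addr o = p ∧ t.label o = z := by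
  induction t generalizing p with
  | var y =>
    cases p with
    | nil =>
      constructor
      · intro hp
        simp only [posOf, subtreeAt, Set.mem_ofPred_eq, Option.some.injEq, var.injEq] at hp
        exact ⟨(), rfl, hp⟩
      · rintro ⟨o, -, ho⟩
        simp only [label] at ho
        simp [posOf, subtreeAt, ho]
    | cons i p =>
      constructor
      · intro hp
        simp [posOf, subtreeAt] at hp
      · rintro ⟨o, ho, -⟩
        simp [addr] at ho
  | node σ ts ih =>
    cases p with
    | nil =>
      constructor
      · intro hp
        simp [posOf, subtreeAt] at hp
      · rintro ⟨⟨i, o⟩, ho, -⟩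
        simp [addr] at ho
    | cons i p =>
      constructor
      · intro hp
        by_cases hi : i < rk σ
        · have hp' : p ∈ (ts ⟨i, hi⟩).posOf z := by
            simpa [posOf, subtreeAt, hi] using hp
          obtain ⟨o, h1, h2⟩ := (ih ⟨i, hi⟩ p).1 hp'
          exact ⟨⟨⟨i, hi⟩, o⟩, by simp [addr, h1], by simp [label, h2]⟩
        · simp [posOf, subtreeAt, hi] at hp
      · rintro ⟨⟨j, o⟩, h1, h2⟩
        simp only [addr, List.cons.injEq] at h1
        obtain ⟨rfl, h1⟩ := h1
        have := (ih j p).2 ⟨o, h1, by simpa [label] using h2⟩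
        simpa [posOf, subtreeAt] using this

theorem posVar_relabel (t : RTree rk Z) (f : List ℕ → Z → W) :
    (t.relabel f).posVar = t.posVar := by
  ext p
  induction t generalizing p f with
  | var z => cases p <;> simp [posVar, posOf, relabel, subtreeAt]
  | node σ ts ih =>
    cases p with
    | nil => simp [posVar, posOf, relabel, subtreeAt]
    | cons i p =>
      by_cases hi : i < rk σ
      · have := ih ⟨i, hi⟩ (fun p z => f (i :: p) z) p
        simpa [posVar, posOf, relabel, subtreeAt, hi] using this
      · simp [posVar, posOf, relabel, subtreeAt, hi]

theorem plug_injective (t : RTree rk Z) :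
    Function.Injective (t.plug : (t.Occ → RTree rk W) → RTree rk W) := by
  induction t with
  | var z => intro θ θ' hθ; funext o; cases o; exact hθ
  | node σ ts ih =>
    intro θ θ' hθ
    simp only [plug, node.injEq, heq_eq_eq, true_and] at hθ
    funext ⟨i, o⟩
    exact congrFun (ih i (congrFun hθ i)) o

theorem height_le_plug (t : RTree rk Z) (θ : t.Occ → RTree rk W) (o : t.Occ) :
    (θ o).height ≤ (t.plug θ).height := by
  induction t with
  | var z => exact le_rfl
  | node σ ts ih =>
    obtain ⟨i, o⟩ := o
    refine (ih i (fun o => θ ⟨i, o⟩) o).trans ?_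
    simp only [plug, height]
    exact (Nat.le_succ _).trans
      (Finset.le_sup (f := fun i => ((ts i).plug fun o => θ ⟨i, o⟩).height + 1)
        (Finset.mem_univ i))

theorem height_lt_plug (t : RTree rk Z) (ht : ∀ z, t ≠ .var z) (θ : t.Occ → RTree rk W)
    (o : t.Occ) : (θ o).height < (t.plug θ).height := by
  cases t with
  | var z => exact absurd rfl (ht z)
  | node σ ts =>
    obtain ⟨i, o⟩ := o
    refine (Nat.lt_succ_of_le (height_le_plug (ts i) (fun o => θ ⟨i, o⟩) o)).trans_le ?_
    simp only [plug, height]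
    exact Finset.le_sup (f := fun i => ((ts i).plug fun o => θ ⟨i, o⟩).height + 1)
      (Finset.mem_univ i)

/-- The set `pos_□(C)` of the holes of a tree `C ∈ T_Δ({□})`; the set `{□}` is `Unit`. -/
def holes (C : RTree rk Unit) : Set (List ℕ) := C.posOf ()

/-- A multi-context is a tree in `T_Δ({□}) ∖ T_Δ`. -/
def IsMultiContext (C : RTree rk Unit) : Prop := C.holes.Nonempty

/-- The tree `C[t]` obtained by putting `t` into every hole of `C`. -/
def fill (C : RTree rk Unit) (t : RTree rk Empty) : RTree rk Empty := C.subst fun _ => t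

end RTree

/-! # Tree homomorphisms -/

/-- A tree homomorphism, given by the trees `h(σ) ∈ T_Δ(X_k)` for `σ` of rank `k`;
the set `X_k` of variables is `Fin k`. -/
structure TreeHom {S D : Type*} (rkS : S → ℕ) (rkD : D → ℕ) where
  img : (σ : S) → RTree rkD (Fin (rkS σ))

namespace TreeHom

variable {S D : Type*} {rkS : S → ℕ} {rkD : D → ℕ}

/-- The induced mapping `h : T_Σ → T_Δ`. -/
def apply (h : TreeHom rkS rkD) : RTree rkS Empty → RTree rkD Empty
  | .var z => z.elim
  | .node σ ts => (h.img σ).subst fun i => h.apply (ts i)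

/-- The tree `h(σ)` as an element of `T_Δ(X)` with `X = {x_0, x_1, …}`, so that `h(σ)` and `h(τ)`
can be compared when the ranks of `σ` and `τ` are not known to be equal. -/
def term (h : TreeHom rkS rkD) (σ : S) : RTree rkD ℕ := (h.img σ).relabel fun _ i => (i : ℕ)

/-- `h(σ)` is never a variable. -/
def Nonerasing (h : TreeHom rkS rkD) : Prop := ∀ σ i, h.img σ ≠ .var i

/-- Every variable of `X_k` occurs in `h(σ)` if `σ` has rank `k`. -/
def Nondeleting (h : TreeHom rkS rkD) : Prop := ∀ σ i, ((h.img σ).posOf i).Nonempty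

/-- Tetris-free tree homomorphisms. -/
structure TetrisFree (h : TreeHom rkS rkD) : Prop where
  nondeleting : h.Nondeleting
  nonerasing : h.Nonerasing
  pos_eq : ∀ s s' : RTree rkS Empty, h.apply s = h.apply s' → s.pos = s'.pos
  term_eq : ∀ s s' : RTree rkS Empty, h.apply s = h.apply s' →
    ∀ p σ τ, s.HasSymbol p σ → s'.HasSymbol p τ → h.term σ = h.term τ

end TreeHom

/-! # Weighted tree automata with hom-constraints -/

/-- A rule `ℓ -E→ q` with `ℓ ∈ T_Δ(Q) ∖ Q`, `q ∈ Q` and an equivalence relation `E` on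
`pos_Q(ℓ)`. -/
@[ext]
structure HomRule {D : Type*} (rk : D → ℕ) (Q : Type*) where
  lhs : RTree rk Q
  constr : Set (List ℕ × List ℕ)
  target : Q
  lhs_ne_var : ∀ q, lhs ≠ .var q
  constr_subset : ∀ p p', (p, p') ∈ constr → p ∈ lhs.posVar ∧ p' ∈ lhs.posVar
  constr_refl : ∀ p ∈ lhs.posVar, (p, p) ∈ constr
  constr_symm : ∀ p p', (p, p') ∈ constr → (p', p) ∈ constr
  constr_trans : ∀ p p' p'', (p, p') ∈ constr → (p', p'') ∈ constr → (p, p'') ∈ constr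

/-- A weighted tree automaton with hom-constraints (WTAh). Only the values of `wt` at elements of
`rules` matter. -/
structure WTAh {D : Type*} (rk : D → ℕ) (Q K : Type*) where
  final : Finset Q
  rules : Finset (HomRule rk Q)
  wt : HomRule rk Q → K

/-- Trees of rules: a rule `ℓ -E→ q` together with a tree of rules for each position in
`pos_Q(ℓ)`. The symbols from `Δ` that occur in a run are those of the left-hand sides and are not
repeated. The runs of an automaton are singled out by `WTAh.IsRun`. -/
inductive RunTree {D : Type*} (rk : D → ℕ) (Q : Type*) where
  | mk (r : HomRule rk Q) (sub : r.lhs.Occ → RunTree rk Q) : RunTree rk Q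

namespace RunTree

variable {D : Type*} {rk : D → ℕ} {Q : Type*}

/-- The rule applied at the root. -/
def rule : RunTree rk Q → HomRule rk Q
  | .mk r _ => r

/-- The tree in `T_Δ` that is processed. -/
def tree : RunTree rk Q → RTree rk Empty
  | .mk r sub => r.lhs.plug fun o => (sub o).tree

/-- `ρ.At p ρ'`: in `ρ` a rule is applied at the position `p` of the processed tree, and `ρ'` is
the part of `ρ` below `p`. -/
inductive At : RunTree rk Q → List ℕ → RunTree rk Q → Prop
  | root (ρ : RunTree rk Q) : At ρ [] ρ
  | step (r : HomRule rk Q) (sub : r.lhs.Occ → RunTree rk Q) (o : r.lhs.Occ) (p : List ℕ)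
      (ρ' : RunTree rk Q) (hp : At (sub o) p ρ') : At (.mk r sub) (r.lhs.addr o ++ p) ρ'

/-- The equivalence relation of being mutually constrained by `ρ`, on the positions of the
processed tree `t`. If a rule `ℓ -E→ q` is applied at `p` and `(w, w') ∈ E`, then the subtrees of
`t` at `pw` and `pw'` are required to be equal, so `pwu` and `pw'u` are constrained to each other
for every `u`; the relation is the equivalence relation generated by these pairs. -/
def Constrained (ρ : RunTree rk Q) : List ℕ → List ℕ → Prop :=
  Relation.EqvGen fun x y => ∃ p ρ' w w' u, ρ.At p ρ' ∧ (w, w') ∈ ρ'.rule.constr ∧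
    x = p ++ w ++ u ∧ y = p ++ w' ++ u

end RunTree

namespace WTAh

variable {D : Type*} {rk : D → ℕ} {Q K : Type*}

/-- `ρ` is a run of `A` (for the tree `ρ.tree` to the state `ρ.rule.target`). -/
def IsRun (A : WTAh rk Q K) : RunTree rk Q → Prop
  | .mk r sub => r ∈ A.rules ∧ (∀ o, (sub o).rule.target = r.lhs.label o) ∧
      (∀ o o', (r.lhs.addr o, r.lhs.addr o') ∈ r.constr → (sub o).tree = (sub o').tree) ∧
      ∀ o, A.IsRun (sub o)

/-- The weight of a run. -/
def runWeight [CommSemiring K] (A : WTAh rk Q K) : RunTree rk Q → K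
  | .mk r sub => A.wt r * ∏ o, A.runWeight (sub o)

/-- The runs of `A` for `t` to `q`. -/
def runs (A : WTAh rk Q K) (t : RTree rk Empty) (q : Q) : Set (RunTree rk Q) :=
  {ρ | A.IsRun ρ ∧ ρ.tree = t ∧ ρ.rule.target = q}

theorem finite_isRun (A : WTAh rk Q K) (t : RTree rk Empty) :
    {ρ | A.IsRun ρ ∧ ρ.tree = t}.Finite := by
  induction hn : t.height using Nat.strong_induction_on generalizing t with
  | _ n ih =>
    have key : ∀ r : HomRule rk Q,
        {ρ | ∃ sub, ρ = RunTree.mk r sub ∧ A.IsRun ρ ∧ ρ.tree = t}.Finite := by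
      intro r
      by_cases hr : ∃ θ : r.lhs.Occ → RTree rk Empty, r.lhs.plug θ = t
      · obtain ⟨θ, hθ⟩ := hr
        have hfin : (Set.pi Set.univ fun o => {ρ | A.IsRun ρ ∧ ρ.tree = θ o}).Finite := by
          refine Set.Finite.pi fun o => ih (θ o).height ?_ (θ o) rfl
          rw [← hn, ← hθ]
          exact RTree.height_lt_plug _ r.lhs_ne_var θ o
        refine (hfin.image (RunTree.mk r)).subset ?_
        rintro ρ ⟨sub, rfl, hρ, ht⟩
        refine ⟨sub, fun o _ => ⟨?_, ?_⟩, rfl⟩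
        · simp only [IsRun] at hρ
          exact hρ.2.2.2 o
        · have : (fun o => (sub o).tree) = θ :=
            RTree.plug_injective r.lhs (by rw [hθ]; simpa [RunTree.tree] using ht)
          exact congrFun this o
      · refine Set.finite_empty.subset ?_
        rintro ρ ⟨sub, rfl, -, ht⟩
        exact hr ⟨fun o => (sub o).tree, by simpa [RunTree.tree] using ht⟩
    refine ((A.rules.finite_toSet).biUnion fun r _ => key r).subset ?_
    rintro ⟨r, sub⟩ hρ
    have h1 := hρ.1
    simp only [IsRun] at h1
    exact Set.mem_biUnion (x := r) h1.1 ⟨sub, rfl, hρ.1, hρ.2⟩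

/-- There are only finitely many runs for a tree, so the sum in `stateWeight` is an honest one. -/
theorem finite_runs (A : WTAh rk Q K) (t : RTree rk Empty) (q : Q) : (A.runs t q).Finite :=
  (A.finite_isRun t).subset fun _ hρ => ⟨hρ.1, hρ.2.1⟩

/-- The value `wt^q(t)`: the sum of the weights of all runs of `A` for `t` to `q`. -/
noncomputable def stateWeight [CommSemiring K] (A : WTAh rk Q K) (q : Q) (t : RTree rk Empty) : K :=
  ∑ ρ ∈ (A.finite_runs t q).toFinset, A.runWeight ρ

/-- The tree series `⟦A⟧` recognized by `A`. -/
noncomputable def series [CommSemiring K] (A : WTAh rk Q K) (t : RTree rk Empty) : K :=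
  ∑ q ∈ A.final, A.stateWeight q t

end WTAh

/-! # Weighted tree automata and the automaton for the homomorphic image -/

/-- A rule `σ(q₁, …, q_k) → q` of a weighted tree automaton. -/
structure WTARule {S : Type*} (rk : S → ℕ) (Q : Type*) where
  sym : S
  args : Fin (rk sym) → Q
  target : Q

/-- A weighted tree automaton (WTA) in the classical sense. Only the values of `wt` at elements of
`rules` matter. -/
structure WTA {S : Type*} (rk : S → ℕ) (Q K : Type*) where
  final : Finset Q
  rules : Finset (WTARule rk Q)
  wt : WTARule rk Q → K

namespace TreeHom

variable {S D : Type*} {rkS : S → ℕ} {rkD : D → ℕ} {Q K : Type*}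

open Classical in
/-- The rule `h(σ)⟦q₁, …, q_k⟧ -E→ q` obtained from the rule `σ(q₁, …, q_k) → q`. The state set is
`Q ∪ {⊥}`, which is `Option Q` with `⊥ = none`. In `h(σ)`, for each `i`, the lexicographically
minimal occurrence of `x_i` is replaced by `q_i` and every other one by `⊥`;
`E` is the union of the sets `pos_{x_i}(h(σ)) × pos_{x_i}(h(σ))`. -/
noncomputable def mapRule (h : TreeHom rkS rkD) (hne : h.Nonerasing) (r : WTARule rkS Q) :
    HomRule rkD (Option Q) where
  lhs := (h.img r.sym).relabel fun p i =>
    if ∀ p' ∈ (h.img r.sym).posOf i, p ≤ p' then some (r.args i) else none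
  constr := {e | ∃ i, e.1 ∈ (h.img r.sym).posOf i ∧ e.2 ∈ (h.img r.sym).posOf i}
  target := some r.target
  lhs_ne_var := by
    intro q hq
    have hv := hne r.sym
    cases ht : h.img r.sym with
    | var i => exact hv i ht
    | node δ ts => rw [ht] at hq; simp [RTree.relabel] at hq
  constr_subset := by
    rintro p p' ⟨i, hp, hp'⟩
    rw [RTree.posVar_relabel]
    exact ⟨⟨i, hp⟩, ⟨i, hp'⟩⟩
  constr_refl := by
    intro p hp
    rw [RTree.posVar_relabel] at hp
    obtain ⟨i, hi⟩ := hp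
    exact ⟨i, hi, hi⟩
  constr_symm := by
    rintro p p' ⟨i, hp, hp'⟩
    exact ⟨i, hp', hp⟩
  constr_trans := by
    rintro p p' p'' ⟨i, hp, hp'⟩ ⟨j, hq, hq'⟩
    have hij : i = j := by
      simp only [RTree.posOf, Set.mem_ofPred_eq] at hp' hq
      rw [hp'] at hq
      simpa using hq
    subst hij
    exact ⟨i, hp, hq'⟩

/-- The rule `δ(⊥, …, ⊥) → ⊥` without nontrivial constraints. -/
def sinkRule (rkD : D → ℕ) (Q : Type*) (δ : D) : HomRule rkD (Option Q) where
  lhs := .node δ fun _ => .var none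
  constr := {e | e.1 = e.2 ∧ e.1 ∈ (RTree.node δ fun _ => .var none : RTree rkD (Option Q)).posVar}
  target := none
  lhs_ne_var := by simp
  constr_subset := by
    rintro p p' ⟨h1, h2⟩
    simp only at h1 h2
    subst h1
    exact ⟨h2, h2⟩
  constr_refl := fun p hp => ⟨rfl, hp⟩
  constr_symm := by
    rintro p p' ⟨h1, h2⟩
    simp only at h1 h2
    subst h1
    exact ⟨rfl, h2⟩
  constr_trans := by
    rintro p p' p'' ⟨h1, h2⟩ ⟨h3, -⟩
    simp only at h1 h2 h3
    subst h1 h3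
    exact ⟨rfl, h2⟩

open Classical in
/-- The eq-restricted WTAh with sink state `⊥ = none` that recognizes `h(⟦A⟧)`. Its rules are the
images of the rules of `A`, where the weights of the rules of `A` with the same image are added up,
and the rules `δ(⊥, …, ⊥) → ⊥` with weight `1`. -/
noncomputable def imageWTAh [Fintype D] [CommSemiring K] (h : TreeHom rkS rkD)
    (hne : h.Nonerasing) (A : WTA rkS Q K) : WTAh rkD (Option Q) K where
  final := A.final.image some
  rules := A.rules.image (h.mapRule hne) ∪ Finset.univ.image (sinkRule rkD Q)
  wt r' := if r'.target = none then 1 else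
    ∑ r ∈ A.rules.filter (fun r => h.mapRule hne r = r'), A.wt r

end TreeHom

/-- `P` is a class of positions that are mutually constrained by the run `ρ`: it is the class of
`pw` where `w` is a state position of a rule `ℓ -E→ q` with `q ≠ ⊥` that `ρ` applies at `p`. -/
def RunTree.IsConstraintClass {D : Type*} {rk : D → ℕ} {Q : Type*} (ρ : RunTree rk (Option Q))
    (P : Set (List ℕ)) : Prop :=
  ∃ p ρ' w, ρ.At p ρ' ∧ ρ'.rule.target ≠ none ∧ w ∈ ρ'.rule.lhs.posVar ∧
    P = {x | ρ.Constrained (p ++ w) x}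

/-! Write `v u` for the vector of weights of `h u` at the proper states, an element of `Q → K`. The
claim reduces to linear algebra in this finite-dimensional space.

If the holes of `C` form a constraint class of a run on `C[t₀]`, the constraints reflect one
variable occurrence in a preimage under `h`. So `t₀ = h u₀`, and there is a context `c` over `Σ`
with exactly one hole such that `C[h u] = h (c u)` for all `u`
(`exists_context_of_isConstraintClass`).

The weight of `h (c u)` is a linear functional of `v u` (`exists_series_context_eq`).
Tetris-freeness forces the rule at the root of a run on `h (σ(…))` to a proper state to be the image
of a rule with symbol `σ`. Among the copies of a child only one carries a proper state; the others
carry `⊥` and contribute the factor `1`. Hence the dependence on a child is linear, however often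
`h` copies it.

Finally, the spans of the vectors `v u` with `h u` of height at least `n` decrease with `n` and
become constant from some `N` on. A functional that is nonzero at some `v u₀` with `h u₀` of height
at least `N` therefore cannot vanish on all `v u` with `h u` of height at least `n`, for any `n`.
This `N` depends only on the family `v`, not on `C`. -/

namespace RTree

/-! ### Positions, relabelling and grafting in trees -/

variable {S : Type*} {rk : S → ℕ} {Z W : Type*}

theorem cons_mem_posOf_node {σ : S} {ts : Fin (rk σ) → RTree rk Z} {i : Fin (rk σ)}
    {p : List ℕ} {z : Z} : (i : ℕ) :: p ∈ (node σ ts).posOf z ↔ p ∈ (ts i).posOf z := by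
  simp [posOf, subtreeAt]

theorem nil_notMem_posOf_node {σ : S} {ts : Fin (rk σ) → RTree rk Z} {z : Z} :
    [] ∉ (node σ ts).posOf z := by
  simp [posOf, subtreeAt]

theorem posOf_unique {t : RTree rk Z} {p : List ℕ} {z z' : Z} (hz : p ∈ t.posOf z)
    (hz' : p ∈ t.posOf z') : z = z' := by
  simp only [posOf, Set.mem_ofPred_eq] at hz hz'
  simpa [hz] using hz'

theorem finite_posOf (t : RTree rk Z) (z : Z) : (t.posOf z).Finite := by
  refine (Set.finite_range t.addr).subset fun p hp => ?_
  obtain ⟨o, ho, -⟩ := (mem_posOf_iff t p z).1 hp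
  exact ⟨o, ho⟩

/-- Positions of labelled leaves form a prefix-free set. -/
theorem addr_append_inj (t : RTree rk Z) {o o' : t.Occ} {x y : List ℕ}
    (hxy : t.addr o ++ x = t.addr o' ++ y) : o = o' ∧ x = y := by
  induction t with
  | var z => exact ⟨rfl, by simpa [addr] using hxy⟩
  | node σ ts ih =>
    obtain ⟨i, o⟩ := o
    obtain ⟨j, o'⟩ := o'
    simp only [addr, List.cons_append, List.cons.injEq, Fin.val_inj] at hxy
    obtain ⟨rfl, hxy⟩ := hxy
    obtain ⟨rfl, rfl⟩ := ih i hxy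
    exact ⟨rfl, rfl⟩

theorem addr_injective (t : RTree rk Z) : Function.Injective t.addr := fun o o' ho =>
  (t.addr_append_inj (x := []) (y := []) (by rw [ho])).1

theorem exists_occ_of_mem_posVar {t : RTree rk Z} {p : List ℕ} (hp : p ∈ t.posVar) :
    ∃ o, t.addr o = p := by
  obtain ⟨z, hz⟩ := hp
  obtain ⟨o, ho, -⟩ := (mem_posOf_iff t p z).1 hz
  exact ⟨o, ho⟩

theorem exists_mem_posOf_of_occ_relabel (t : RTree rk Z) (f : List ℕ → Z → W)
    (o : (t.relabel f).Occ) :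
    ∃ z, (t.relabel f).addr o ∈ t.posOf z ∧
      (t.relabel f).label o = f ((t.relabel f).addr o) z := by
  induction t generalizing f with
  | var z => exact ⟨z, by simp [posOf, subtreeAt, relabel, addr], rfl⟩
  | node σ ts ih =>
    obtain ⟨i, o⟩ := o
    obtain ⟨z, hz, hl⟩ := ih i _ o
    exact ⟨z, cons_mem_posOf_node.2 hz, hl⟩

theorem exists_occ_relabel_of_mem_posOf {t : RTree rk Z} (f : List ℕ → Z → W) {p : List ℕ} {z : Z}
    (hp : p ∈ t.posOf z) :
    ∃ o, (t.relabel f).addr o = p ∧ (t.relabel f).label o = f p z := by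
  have hp' : p ∈ (t.relabel f).posVar := by
    rw [posVar_relabel]
    exact ⟨z, hp⟩
  obtain ⟨o, rfl⟩ := exists_occ_of_mem_posVar hp'
  obtain ⟨z', hz', hl⟩ := exists_mem_posOf_of_occ_relabel t f o
  rw [posOf_unique hp hz']
  exact ⟨o, rfl, hl⟩

theorem plug_relabel_eq_subst (t : RTree rk Z) {V : Type*} (f : List ℕ → Z → W)
    (θ : (t.relabel f).Occ → RTree rk V) (g : Z → RTree rk V)
    (hg : ∀ o z, (t.relabel f).addr o ∈ t.posOf z → θ o = g z) :
    (t.relabel f).plug θ = t.subst g := by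
  induction t generalizing f with
  | var z => exact hg () z (by simp [posOf, subtreeAt, relabel, addr])
  | node σ ts ih =>
    simp only [relabel, plug, subst, node.injEq, heq_eq_eq, true_and]
    funext i
    exact ih i _ _ fun o z ho => hg ⟨i, o⟩ z (cons_mem_posOf_node.2 ho)

theorem relabel_relabel {V : Type*} (t : RTree rk Z) (f : List ℕ → Z → W) (g : List ℕ → W → V) :
    (t.relabel f).relabel g = t.relabel fun p z => g p (f p z) := by
  induction t generalizing f g with
  | var z => rfl
  | node σ ts ih =>
    simp only [relabel, node.injEq, heq_eq_eq, true_and]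
    funext i
    exact ih i _ _

theorem posOf_relabel_of_injective (t : RTree rk Z) {f : Z → W} (hf : f.Injective) (z : Z) :
    (t.relabel fun _ => f).posOf (f z) = t.posOf z := by
  ext p
  rw [mem_posOf_iff]
  constructor
  · rintro ⟨o, rfl, hl⟩
    obtain ⟨z', hz', hl'⟩ := exists_mem_posOf_of_occ_relabel t (fun _ => f) o
    rwa [← hf (hl'.symm.trans hl)]
  · exact exists_occ_relabel_of_mem_posOf _

open Classical in
/-- The tree obtained from a tree by putting `t` at all positions in `H`. -/
noncomputable def graft : RTree rk Empty → Set (List ℕ) → RTree rk Empty → RTree rk Empty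
  | .var z, _, _ => .var z
  | .node σ ts, H, t =>
    if [] ∈ H then t else .node σ fun i => (ts i).graft {p | (i : ℕ) :: p ∈ H} t

theorem graft_of_nil_mem (T : RTree rk Empty) {H : Set (List ℕ)} (hH : [] ∈ H)
    (t : RTree rk Empty) : T.graft H t = t := by
  cases T with
  | var z => exact z.elim
  | node σ ts => simp [graft, hH]

theorem graft_empty (T t : RTree rk Empty) : T.graft ∅ t = T := by
  induction T with
  | var z => exact z.elim
  | node σ ts ih =>
    simp only [graft, Set.mem_empty_iff_false, if_false, node.injEq, heq_eq_eq, true_and]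
    funext i
    exact ih i

/-- This removes `C` from the argument: only its set of holes matters, and that set is described by
a run on `C.fill t₀`. -/
theorem fill_eq_graft (C : RTree rk Unit) (t₀ t : RTree rk Empty) :
    C.fill t = (C.fill t₀).graft C.holes t := by
  induction C with
  | var z => exact (graft_of_nil_mem _ (by simp [holes, posOf, subtreeAt]) _).symm
  | node σ ts ih =>
    have hn : [] ∉ (node σ ts).holes := nil_notMem_posOf_node
    simp only [fill, subst, graft, hn, if_false, node.injEq, heq_eq_eq, true_and]
    funext i
    have : {p | (i : ℕ) :: p ∈ (node σ ts).holes} = (ts i).holes :=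
      Set.ext fun p => cons_mem_posOf_node
    rw [this]
    exact ih i

/-- By `hH` no position of `H` is a proper prefix of a leaf address, so grafting leaves `l` intact
and acts separately on the plugged trees. -/
theorem graft_plug (l : RTree rk Z) (θ : l.Occ → RTree rk Empty) (H : Set (List ℕ))
    (hH : ∀ x ∈ H, ∃ o y, x = l.addr o ++ y) (t : RTree rk Empty) :
    (l.plug θ).graft H t = l.plug fun o => (θ o).graft {x | l.addr o ++ x ∈ H} t := by
  induction l generalizing H with
  | var z => rfl
  | node σ ts ih =>
    have hn : [] ∉ H := fun h => by
      obtain ⟨⟨i, o⟩, y, hy⟩ := hH _ h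
      simp [addr] at hy
    simp only [plug, graft, hn, if_false, node.injEq, heq_eq_eq, true_and]
    funext i
    refine ih i _ _ fun x hx => ?_
    obtain ⟨⟨j, o⟩, y, hy⟩ := hH _ hx
    simp only [addr, List.cons_append, List.cons.injEq, Fin.val_inj] at hy
    obtain ⟨rfl, rfl⟩ := hy
    exact ⟨o, y, rfl⟩

theorem subtreeAt_hole (C : RTree rk Unit) (t : RTree rk Empty) {p : List ℕ} (hp : p ∈ C.holes) :
    (C.fill t).subtreeAt p = some t := by
  induction C generalizing p with
  | var z => cases p <;> simp_all [holes, posOf, subtreeAt, fill, subst]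
  | node σ ts ih =>
    cases p with
    | nil => exact absurd hp nil_notMem_posOf_node
    | cons i p =>
      by_cases hi : i < rk σ
      · have := ih ⟨i, hi⟩ (p := p) (by simpa [holes, posOf, subtreeAt, hi] using hp)
        simpa [fill, subst, subtreeAt, hi] using this
      · simp [holes, posOf, subtreeAt, hi] at hp

theorem subtreeAt_plug (l : RTree rk Z) (θ : l.Occ → RTree rk W) (o : l.Occ) (p : List ℕ) :
    (l.plug θ).subtreeAt (l.addr o ++ p) = (θ o).subtreeAt p := by
  induction l with
  | var z => rfl
  | node σ ts ih =>
    obtain ⟨i, o⟩ := o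
    simpa [plug, addr, subtreeAt] using ih i (fun o => θ ⟨i, o⟩) o

end RTree

/-! ### Factorization of run weights at the root rule -/

namespace WTAh

variable {D : Type*} {rk : D → ℕ} {Q K : Type*} [CommSemiring K]

open Classical in
/-- The sum of the weights of the runs for `t` to `q` that apply the rule `r` at the root. -/
noncomputable def ruleWeight (A : WTAh rk Q K) (q : Q) (t : RTree rk Empty) (r : HomRule rk Q) :
    K :=
  ∑ ρ ∈ (A.finite_runs t q).toFinset.filter (fun ρ => ρ.rule = r), A.runWeight ρ

theorem stateWeight_eq_sum_ruleWeight (A : WTAh rk Q K) (q : Q) (t : RTree rk Empty) :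
    A.stateWeight q t = ∑ r ∈ A.rules, A.ruleWeight q t r := by
  classical
  refine (Finset.sum_fiberwise_of_maps_to (fun ρ hρ => ?_) _).symm
  obtain ⟨r, sub⟩ := ρ
  have h1 := ((Set.Finite.mem_toFinset _).1 hρ).1
  simp only [IsRun] at h1
  exact h1.1

theorem ruleWeight_eq_zero {A : WTAh rk Q K} {q : Q} {t : RTree rk Empty} {r : HomRule rk Q}
    (hr : ∀ ρ ∈ A.runs t q, ρ.rule ≠ r) : A.ruleWeight q t r = 0 := by
  classical
  refine Finset.sum_eq_zero fun ρ hρ => ?_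
  rw [Finset.mem_filter, Set.Finite.mem_toFinset] at hρ
  exact absurd hρ.2 (hr ρ hρ.1)

/-- As `plug` is injective, a run with root rule `r` is a tuple of runs on the trees `θ o`. The
constraints at the root concern only these trees, so by `hθ` every tuple is admissible and the sum
over tuples becomes a product of sums. -/
theorem ruleWeight_plug (A : WTAh rk Q K) {r : HomRule rk Q} (hr : r ∈ A.rules)
    (θ : r.lhs.Occ → RTree rk Empty)
    (hθ : ∀ o o', (r.lhs.addr o, r.lhs.addr o') ∈ r.constr → θ o = θ o') :
    A.ruleWeight r.target (r.lhs.plug θ) r =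
      A.wt r * ∏ o, A.stateWeight (r.lhs.label o) (θ o) := by
  classical
  simp only [stateWeight]
  rw [Finset.prod_univ_sum, Finset.mul_sum]
  symm
  refine Finset.sum_bij (fun sub _ => RunTree.mk r sub) ?_ ?_ ?_ ?_
  · intro sub hsub
    simp only [Fintype.mem_piFinset, Set.Finite.mem_toFinset] at hsub
    rw [Finset.mem_filter, Set.Finite.mem_toFinset]
    refine ⟨⟨?_, ?_, rfl⟩, rfl⟩
    · simp only [IsRun]
      refine ⟨hr, fun o => (hsub o).2.2, fun o o' ho => ?_, fun o => (hsub o).1⟩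
      rw [(hsub o).2.1, (hsub o').2.1, hθ o o' ho]
    · simp only [RunTree.tree]
      congr 1
      funext o
      exact (hsub o).2.1
  · intro sub _ sub' _ h
    simpa using h
  · rintro ⟨r', sub⟩ hρ
    rw [Finset.mem_filter, Set.Finite.mem_toFinset] at hρ
    obtain ⟨⟨h1, h2, -⟩, h4⟩ := hρ
    simp only [RunTree.rule] at h4
    subst h4
    simp only [IsRun] at h1
    refine ⟨sub, ?_, rfl⟩
    simp only [Fintype.mem_piFinset, Set.Finite.mem_toFinset]
    have h3 := RTree.plug_injective _ (by simpa only [RunTree.tree] using h2)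
    exact fun o => ⟨h1.2.2.2 o, congrFun h3 o, h1.2.1 o⟩
  · intro sub _
    simp only [runWeight]

end WTAh

/-! ### Subruns and the constraint relation -/

namespace RunTree

variable {D : Type*} {rk : D → ℕ} {Q : Type*}

theorem At.subtreeAt_tree {ρ ρ' : RunTree rk Q} {p : List ℕ} (hp : ρ.At p ρ') :
    ρ.tree.subtreeAt p = some ρ'.tree := by
  induction hp with
  | root ρ =>
    cases h : ρ.tree <;> rfl
  | step r sub o p ρ' _ ih =>
    simp only [tree]
    rw [RTree.subtreeAt_plug, ih]

theorem At.trans {ρ ρ' ρ'' : RunTree rk Q} {p p' : List ℕ} (hp : ρ.At p ρ') (hp' : ρ'.At p' ρ'') :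
    ρ.At (p ++ p') ρ'' := by
  induction hp with
  | root ρ => exact hp'
  | step r sub o p ρ' _ ih =>
    rw [List.append_assoc]
    exact .step r sub o _ _ (ih hp')

theorem at_addr (r : HomRule rk Q) (sub : r.lhs.Occ → RunTree rk Q) (o : r.lhs.Occ) :
    (mk r sub).At (r.lhs.addr o) (sub o) := by
  simpa using At.step r sub o [] _ (.root _)

theorem At.isRun {K : Type*} {A : WTAh rk Q K} {ρ ρ' : RunTree rk Q} {p : List ℕ}
    (hp : ρ.At p ρ') (hρ : A.IsRun ρ) : A.IsRun ρ' := by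
  induction hp with
  | root ρ => exact hρ
  | step r sub o p ρ' _ ih =>
    simp only [WTAh.IsRun] at hρ
    exact ih (hρ.2.2.2 o)

theorem constrained_of_constr {ρ ρ' : RunTree rk Q} {p w w' : List ℕ} (hp : ρ.At p ρ')
    (hw : (w, w') ∈ ρ'.rule.constr) (u : List ℕ) :
    ρ.Constrained (p ++ w ++ u) (p ++ w' ++ u) :=
  .rel _ _ ⟨p, ρ', w, w', u, hp, hw, rfl, rfl⟩

theorem Constrained.append_addr {r : HomRule rk Q} {sub : r.lhs.Occ → RunTree rk Q} {o : r.lhs.Occ}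
    {x y : List ℕ} (hxy : (sub o).Constrained x y) :
    (mk r sub).Constrained (r.lhs.addr o ++ x) (r.lhs.addr o ++ y) := by
  induction hxy with
  | rel x y h =>
    obtain ⟨p, ρ', w, w', u, hp, hw, rfl, rfl⟩ := h
    have := constrained_of_constr (At.step r sub o p ρ' hp) hw u
    simpa [List.append_assoc] using this
  | refl x => exact .refl _
  | symm x y _ ih => exact ih.symm
  | trans x y z _ _ ih ih' => exact ih.trans _ _ _ ih'

/-- A set that is closed under the generators of the constraint relation is a union of classes. -/
theorem Constrained.mem_iff {ρ : RunTree rk Q} {X : Set (List ℕ)}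
    (hX : ∀ p ρ' w w' u, ρ.At p ρ' → (w, w') ∈ ρ'.rule.constr → p ++ w ++ u ∈ X →
      p ++ w' ++ u ∈ X) {x y : List ℕ} (hxy : ρ.Constrained x y) : x ∈ X ↔ y ∈ X := by
  induction hxy with
  | rel x y h =>
    obtain ⟨p, ρ', w, w', u, hp, hw, rfl, rfl⟩ := h
    exact ⟨hX _ _ _ _ _ hp hw, hX _ _ _ _ _ hp (ρ'.rule.constr_symm _ _ hw)⟩
  | refl x => exact Iff.rfl
  | symm x y _ ih => exact ih.symm
  | trans x y z _ _ ih ih' => exact ih.trans ih'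

end RunTree

/-! ### Images of rules under the homomorphism -/

namespace TreeHom

variable {S D : Type*} {rkS : S → ℕ} {rkD : D → ℕ} {Q K : Type*}

theorem exists_addr_mem_posOf (h : TreeHom rkS rkD) (hne : h.Nonerasing) (r : WTARule rkS Q)
    (o : (h.mapRule hne r).lhs.Occ) :
    ∃ i, (h.mapRule hne r).lhs.addr o ∈ (h.img r.sym).posOf i := by
  obtain ⟨i, hi, -⟩ := RTree.exists_mem_posOf_of_occ_relabel _ _ o
  exact ⟨i, hi⟩

open Classical in
theorem label_mapRule_eq (h : TreeHom rkS rkD) (hne : h.Nonerasing) (r : WTARule rkS Q)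
    {o : (h.mapRule hne r).lhs.Occ} {i : Fin (rkS r.sym)}
    (hi : (h.mapRule hne r).lhs.addr o ∈ (h.img r.sym).posOf i) :
    (h.mapRule hne r).lhs.label o =
      if ∀ p' ∈ (h.img r.sym).posOf i, (h.mapRule hne r).lhs.addr o ≤ p' then some (r.args i)
      else none := by
  obtain ⟨j, hj, hl⟩ := RTree.exists_mem_posOf_of_occ_relabel _ _ o
  rw [RTree.posOf_unique hi hj]
  exact hl

theorem exists_occ_label_eq_some {h : TreeHom rkS rkD} (hne : h.Nonerasing) (hnd : h.Nondeleting)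
    (r : WTARule rkS Q) (i : Fin (rkS r.sym)) :
    ∃ o, (h.mapRule hne r).lhs.addr o ∈ (h.img r.sym).posOf i ∧
      (h.mapRule hne r).lhs.label o = some (r.args i) := by
  classical
  obtain ⟨p, hp, hmin⟩ := Set.exists_min_image _ id ((h.img r.sym).finite_posOf i) (hnd r.sym i)
  obtain ⟨o, rfl, -⟩ := RTree.exists_occ_relabel_of_mem_posOf (fun p i =>
    if ∀ p' ∈ (h.img r.sym).posOf i, p ≤ p' then some (r.args i) else none) hp
  exact ⟨o, hp, (h.label_mapRule_eq hne r hp).trans (if_pos hmin)⟩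

theorem label_eq_none_of_ne {h : TreeHom rkS rkD} (hne : h.Nonerasing) (r : WTARule rkS Q)
    {o o' : (h.mapRule hne r).lhs.Occ} {i : Fin (rkS r.sym)}
    (hi : (h.mapRule hne r).lhs.addr o ∈ (h.img r.sym).posOf i)
    (hi' : (h.mapRule hne r).lhs.addr o' ∈ (h.img r.sym).posOf i) (hoo' : o' ≠ o)
    (ho : (h.mapRule hne r).lhs.label o ≠ none) : (h.mapRule hne r).lhs.label o' = none := by
  classical
  rw [label_mapRule_eq h hne r hi] at ho
  rw [label_mapRule_eq h hne r hi']
  refine if_neg fun hmin => hoo' (RTree.addr_injective _ ?_)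
  have hmin' := (ite_ne_right_iff.1 ho).1
  exact le_antisymm (hmin _ hi) (hmin' _ hi')

theorem plug_mapRule (h : TreeHom rkS rkD) (hne : h.Nonerasing) (r : WTARule rkS Q)
    {θ : (h.mapRule hne r).lhs.Occ → RTree rkD Empty} {ts : Fin (rkS r.sym) → RTree rkS Empty}
    (hθ : ∀ o i, (h.mapRule hne r).lhs.addr o ∈ (h.img r.sym).posOf i → θ o = h.apply (ts i)) :
    (h.mapRule hne r).lhs.plug θ = h.apply (.node r.sym ts) := by
  rw [apply]
  exact RTree.plug_relabel_eq_subst _ _ _ _ hθ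

/-- The term of `σ` and the rank of `σ` determine the image of a rule. -/
theorem mapRule_congr (h : TreeHom rkS rkD) (hne : h.Nonerasing) {σ : S} (r : WTARule rkS Q)
    (hrk : rkS r.sym = rkS σ) (hterm : h.term r.sym = h.term σ) :
    h.mapRule hne r = h.mapRule hne ⟨σ, fun i => r.args (Fin.cast hrk.symm i), r.target⟩ := by
  classical
  have hpos : ∀ τ (i : Fin (rkS τ)), (h.img τ).posOf i = (h.term τ).posOf i := fun τ i =>
    (RTree.posOf_relabel_of_injective (h.img τ) Fin.val_injective i).symm
  -- Apart from `r.args`, the right-hand side depends on the symbol only through its term and its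
  -- rank. The inner default `none` is never reached, since the labels of the term are below the
  -- rank.
  have hlhs : ∀ r : WTARule rkS Q, (h.mapRule hne r).lhs = (h.term r.sym).relabel fun p n =>
      if ∀ p' ∈ (h.term r.sym).posOf n, p ≤ p' then
        (if hn : n < rkS r.sym then some (r.args ⟨n, hn⟩) else none) else none := fun r => by
    rw [term, RTree.relabel_relabel]
    simp only [mapRule, hpos, term, Fin.is_lt, dite_true, Fin.eta]
  ext1
  · rw [hlhs, hlhs]
    simp only [hterm, hrk]
    rfl
  · ext ⟨p, p'⟩
    simp only [mapRule, hpos, hterm]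
    constructor
    · rintro ⟨i, hi⟩
      exact ⟨Fin.cast hrk i, hi⟩
    · rintro ⟨i, hi⟩
      exact ⟨Fin.cast hrk.symm i, hi⟩
  · rfl

/-- Otherwise the variable with index `rkS τ` would occur in `h(σ)`, hence in `h(τ)`, whose
variables all have smaller index. -/
theorem rank_le_of_term_eq {h : TreeHom rkS rkD} (hnd : h.Nondeleting) {σ τ : S}
    (hterm : h.term σ = h.term τ) : rkS σ ≤ rkS τ := by
  by_contra! hlt
  obtain ⟨p, hp⟩ := hnd σ ⟨rkS τ, hlt⟩
  rw [← RTree.posOf_relabel_of_injective (h.img σ) Fin.val_injective] at hp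
  change p ∈ (h.term σ).posOf (rkS τ) at hp
  rw [hterm] at hp
  obtain ⟨o, rfl, hl⟩ := (RTree.mem_posOf_iff _ _ _).1 hp
  obtain ⟨i, -, hi⟩ := RTree.exists_mem_posOf_of_occ_relabel _ _ o
  exact (i.2.ne (hi.symm.trans hl))

/-! ### Runs of the image automaton -/

variable [Fintype D] [CommSemiring K]

theorem exists_mapRule_eq {h : TreeHom rkS rkD} {hne : h.Nonerasing} {A : WTA rkS Q K}
    {r : HomRule rkD (Option Q)} (hr : r ∈ (h.imageWTAh hne A).rules) (ht : r.target ≠ none) :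
    ∃ r₀ ∈ A.rules, h.mapRule hne r₀ = r := by
  classical
  simp only [imageWTAh, Finset.mem_union, Finset.mem_image, Finset.mem_univ, true_and] at hr
  obtain hr | ⟨δ, rfl⟩ := hr
  · exact hr
  · exact absurd rfl ht

theorem exists_sinkRule_eq {h : TreeHom rkS rkD} {hne : h.Nonerasing} {A : WTA rkS Q K}
    {r : HomRule rkD (Option Q)} (hr : r ∈ (h.imageWTAh hne A).rules) (ht : r.target = none) :
    ∃ δ, sinkRule rkD Q δ = r := by
  classical
  simp only [imageWTAh, Finset.mem_union, Finset.mem_image, Finset.mem_univ, true_and] at hr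
  obtain ⟨r₀, -, rfl⟩ | hr := hr
  · simp [mapRule] at ht
  · exact hr

/-- Rules with target `⊥` have only `⊥` at their leaves, so once a run has entered the sink it stays
there on the way down. -/
theorem target_ne_none_of_at {h : TreeHom rkS rkD} {hne : h.Nonerasing} {A : WTA rkS Q K}
    {ρ ρ' : RunTree rkD (Option Q)} {p : List ℕ} (hρ : (h.imageWTAh hne A).IsRun ρ)
    (hp : ρ.At p ρ') (ht : ρ'.rule.target ≠ none) : ρ.rule.target ≠ none := by
  induction hp with
  | root ρ => exact ht
  | step r sub o p ρ' _ ih =>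
    simp only [WTAh.IsRun] at hρ
    intro hn
    obtain ⟨δ, rfl⟩ := exists_sinkRule_eq hρ.1 hn
    exact ih (hρ.2.2.2 o) ht (hρ.2.1 o)

theorem eq_of_mem_constr_of_target_eq_none {h : TreeHom rkS rkD} {hne : h.Nonerasing}
    {A : WTA rkS Q K} {ρ ρ' : RunTree rkD (Option Q)} {p w w' : List ℕ}
    (hρ : (h.imageWTAh hne A).IsRun ρ) (ht : ρ.rule.target = none) (hp : ρ.At p ρ')
    (hw : (w, w') ∈ ρ'.rule.constr) : w = w' := by
  by_cases ht' : ρ'.rule.target = none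
  · have hρ' := hp.isRun hρ
    obtain ⟨r, sub⟩ := ρ'
    simp only [WTAh.IsRun] at hρ'
    obtain ⟨δ, rfl⟩ := exists_sinkRule_eq hρ'.1 ht'
    exact hw.1
  · exact absurd ht (target_ne_none_of_at hρ hp ht')

/-- Each variable has an occurrence with a proper state, whose tree is in the image of `h` by
`hsub`; the constraints carry this tree to the other occurrences. Keeping `hsub` as a hypothesis
lets the lemma serve as the induction step of `exists_apply_eq_tree`, which then supplies `hsub`. -/
theorem exists_children_aux {h : TreeHom rkS rkD} {hne : h.Nonerasing} (hnd : h.Nondeleting)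
    {A : WTA rkS Q K} {r : WTARule rkS Q} {sub : (h.mapRule hne r).lhs.Occ → RunTree rkD (Option Q)}
    (hρ : (h.imageWTAh hne A).IsRun (.mk (h.mapRule hne r) sub))
    (hsub : ∀ o, (sub o).rule.target ≠ none → ∃ s, (sub o).tree = h.apply s) :
    ∃ ts : Fin (rkS r.sym) → RTree rkS Empty, ∀ o i,
      (h.mapRule hne r).lhs.addr o ∈ (h.img r.sym).posOf i → (sub o).tree = h.apply (ts i) := by
  simp only [WTAh.IsRun] at hρ
  have key : ∀ i, ∃ s, ∀ o, (h.mapRule hne r).lhs.addr o ∈ (h.img r.sym).posOf i →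
      (sub o).tree = h.apply s := fun i => by
    obtain ⟨o, ho, hl⟩ := exists_occ_label_eq_some hne hnd r i
    obtain ⟨s, hs⟩ := hsub o (by rw [hρ.2.1 o, hl]; simp)
    exact ⟨s, fun o' ho' => (hρ.2.2.1 o' o ⟨i, ho', ho⟩).trans hs⟩
  choose ts hts using key
  exact ⟨ts, fun o i => hts i o⟩

/-- Only trees in the image of `h` have runs to proper states. -/
theorem exists_apply_eq_tree {h : TreeHom rkS rkD} {hne : h.Nonerasing} (hnd : h.Nondeleting)
    {A : WTA rkS Q K} {ρ : RunTree rkD (Option Q)} (hρ : (h.imageWTAh hne A).IsRun ρ)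
    (ht : ρ.rule.target ≠ none) : ∃ s, ρ.tree = h.apply s := by
  induction ρ with
  | mk r sub ih =>
    have hρ' := hρ
    simp only [WTAh.IsRun] at hρ'
    obtain ⟨r, -, rfl⟩ := exists_mapRule_eq hρ'.1 ht
    obtain ⟨ts, hts⟩ := exists_children_aux hnd hρ fun o => ih o (hρ'.2.2.2 o)
    exact ⟨_, plug_mapRule h hne r hts⟩

theorem exists_children {h : TreeHom rkS rkD} {hne : h.Nonerasing} (hnd : h.Nondeleting)
    {A : WTA rkS Q K} {r : WTARule rkS Q} {sub : (h.mapRule hne r).lhs.Occ → RunTree rkD (Option Q)}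
    (hρ : (h.imageWTAh hne A).IsRun (.mk (h.mapRule hne r) sub)) :
    ∃ ts : Fin (rkS r.sym) → RTree rkS Empty, ∀ o i,
      (h.mapRule hne r).lhs.addr o ∈ (h.img r.sym).posOf i → (sub o).tree = h.apply (ts i) := by
  refine exists_children_aux hnd hρ fun o ho =>
    exists_apply_eq_tree (hne := hne) (A := A) hnd ?_ ho
  simp only [WTAh.IsRun] at hρ
  exact hρ.2.2.2 o

/-- The symbol at each node determines the only applicable sink rule, and these rules have weight
`1` and trivial constraints. -/
theorem stateWeight_none (h : TreeHom rkS rkD) (hne : h.Nonerasing) (A : WTA rkS Q K)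
    (t : RTree rkD Empty) : (h.imageWTAh hne A).stateWeight none t = 1 := by
  classical
  induction t with
  | var z => exact z.elim
  | node δ ts ih =>
    have hmem : sinkRule rkD Q δ ∈ (h.imageWTAh hne A).rules := by simp [imageWTAh]
    rw [WTAh.stateWeight_eq_sum_ruleWeight, Finset.sum_eq_single_of_mem _ hmem]
    · have := WTAh.ruleWeight_plug (h.imageWTAh hne A) hmem (fun o => ts o.1) (by
        rintro o o' ⟨h1, -⟩
        simp only at h1
        rw [RTree.addr_injective _ h1])
      refine this.trans ?_
      have hw : (h.imageWTAh hne A).wt (sinkRule rkD Q δ) = 1 := by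
        simp [imageWTAh, sinkRule]
      rw [hw, one_mul]
      exact Finset.prod_eq_one fun o _ => ih o.1
    · refine fun r' _ hr' => WTAh.ruleWeight_eq_zero ?_
      rintro ⟨r, sub⟩ ⟨hρ, htree, ht⟩ rfl
      simp only [WTAh.IsRun] at hρ
      obtain ⟨δ', rfl⟩ := exists_sinkRule_eq hρ.1 ht
      simp only [RunTree.tree] at htree
      have : (RTree.node δ' fun i => (sub ⟨i, ()⟩).tree : RTree rkD Empty) = .node δ ts := htree
      injection this with h1 h2
      exact hr' (by rw [RunTree.rule, h1])

/-- The root rule may stem from a symbol other than `σ`. Tetris-freeness at the root position makes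
the two terms agree, hence also the ranks, and then the rule can be rewritten with `σ`. The
rewritten rule need not belong to `A`; only its image matters. -/
theorem TetrisFree.exists_mapRule_eq {h : TreeHom rkS rkD} (hh : h.TetrisFree) {A : WTA rkS Q K}
    {σ : S} {ts : Fin (rkS σ) → RTree rkS Empty} {q : Q} {ρ : RunTree rkD (Option Q)}
    (hρ : ρ ∈ (h.imageWTAh hh.nonerasing A).runs (h.apply (.node σ ts)) (some q)) :
    ∃ args, h.mapRule hh.nonerasing ⟨σ, args, q⟩ = ρ.rule := by
  obtain ⟨r', sub⟩ := ρ
  obtain ⟨hρ, htree, ht⟩ := hρ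
  have hρ' := hρ
  simp only [WTAh.IsRun] at hρ'
  obtain ⟨r, -, rfl⟩ := TreeHom.exists_mapRule_eq hρ'.1 (by rw [RunTree.rule] at ht; simp [ht])
  obtain ⟨ts', hts'⟩ := exists_children hh.nondeleting hρ
  have hs := (plug_mapRule h hh.nonerasing r hts').symm.trans htree
  have hterm := hh.term_eq _ _ hs [] r.sym σ ⟨_, rfl⟩ ⟨_, rfl⟩
  have hrk := le_antisymm (rank_le_of_term_eq hh.nondeleting hterm)
    (rank_le_of_term_eq hh.nondeleting hterm.symm)
  have hq : r.target = q := Option.some_injective _ ht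
  exact ⟨_, by rw [← hq]; exact (mapRule_congr h hh.nonerasing r hrk hterm).symm⟩

end TreeHom

/-- The functions `u ↦ c[u]` for contexts `c` with exactly one hole. -/
inductive RTree.IsContext {S : Type*} {rk : S → ℕ} : (RTree rk Empty → RTree rk Empty) → Prop
  | id : IsContext fun u => u
  | node (σ : S) (ts : Fin (rk σ) → RTree rk Empty) (i : Fin (rk σ))
      (c : RTree rk Empty → RTree rk Empty) (hc : IsContext c) :
      IsContext fun u => .node σ (Function.update ts i (c u))

/-! ### One-hole contexts: linear action on weights and relation to constraint classes -/

namespace TreeHom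

variable {S D : Type*} {rkS : S → ℕ} {rkD : D → ℕ} {Q K : Type*} [Fintype D]

/-- The weights of `h(u)` at the proper states. -/
noncomputable def weightVector [CommSemiring K] (h : TreeHom rkS rkD) (hne : h.Nonerasing)
    (A : WTA rkS Q K) (u : RTree rkS Empty) : Q → K :=
  fun q => (h.imageWTAh hne A).stateWeight (some q) (h.apply u)

theorem TetrisFree.exists_ruleWeight_update_eq [CommSemiring K] {h : TreeHom rkS rkD}
    (hh : h.TetrisFree) (A : WTA rkS Q K) (σ : S) (ts : Fin (rkS σ) → RTree rkS Empty)
    (i : Fin (rkS σ)) (q : Q) {r : HomRule rkD (Option Q)}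
    (hr : r ∈ (h.imageWTAh hh.nonerasing A).rules) : ∃ ψ : (Q → K) →ₗ[K] K,
      ∀ u, (h.imageWTAh hh.nonerasing A).ruleWeight (some q)
        (h.apply (.node σ (Function.update ts i u))) r = ψ (h.weightVector hh.nonerasing A u) := by
  classical
  by_cases hr' : ∃ args, h.mapRule hh.nonerasing ⟨σ, args, q⟩ = r
  · obtain ⟨args, rfl⟩ := hr'
    set r₀ : WTARule rkS Q := ⟨σ, args, q⟩
    set r := h.mapRule hh.nonerasing r₀
    set B := h.imageWTAh hh.nonerasing A
    have hlab := exists_addr_mem_posOf h hh.nonerasing r₀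
    choose v hv using hlab
    obtain ⟨o, ho, hl⟩ := exists_occ_label_eq_some hh.nonerasing hh.nondeleting r₀ i
    -- Only the leaf `o` depends on `u`. The other occurrences of the `i`-th variable carry `⊥` and
    -- have weight `1` at every tree, so `ts i` can stand in for `u` there.
    refine ⟨(B.wt r * ∏ o' ∈ Finset.univ.erase o,
      B.stateWeight (r.lhs.label o') (h.apply (ts (v o')))) • LinearMap.proj (args i),
      fun u => ?_⟩
    rw [← plug_mapRule h hh.nonerasing r₀ (θ := fun o' => h.apply (Function.update ts i u (v o')))
      (fun o' j hj => by rw [RTree.posOf_unique hj (hv o')])]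
    refine (B.ruleWeight_plug hr _ ?_).trans ?_
    · rintro o₁ o₂ ⟨j, hj₁, hj₂⟩
      rw [← RTree.posOf_unique hj₁ (hv o₁), ← RTree.posOf_unique hj₂ (hv o₂)]
    · rw [← Finset.mul_prod_erase _ _ (Finset.mem_univ o), LinearMap.smul_apply,
        LinearMap.proj_apply, smul_eq_mul, mul_assoc]
      congr 1
      rw [mul_comm]
      congr 1
      · refine Finset.prod_congr rfl fun o' ho' => ?_
        by_cases hvo : v o' = i
        · have : r.lhs.label o' = none := label_eq_none_of_ne hh.nonerasing r₀ ho
            (hvo ▸ hv o') (Finset.ne_of_mem_erase ho') (by rw [hl]; simp)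
          rw [this, stateWeight_none, stateWeight_none]
        · rw [Function.update_of_ne hvo]
      · rw [hl, ← RTree.posOf_unique ho (hv o), Function.update_self]
        rfl
  -- If `r` is not the image of a rule with symbol `σ` and target `q`, tetris-freeness excludes it
  -- at the root of all these runs.
  · refine ⟨0, fun u => WTAh.ruleWeight_eq_zero fun ρ hρ hρr => hr' ?_⟩
    rw [← hρr]
    exact hh.exists_mapRule_eq hρ

theorem TetrisFree.exists_stateWeight_context_eq [CommSemiring K] {h : TreeHom rkS rkD}
    (hh : h.TetrisFree) (A : WTA rkS Q K) {c : RTree rkS Empty → RTree rkS Empty}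
    (hc : RTree.IsContext c) : ∃ L : (Q → K) →ₗ[K] Q → K,
      ∀ u, h.weightVector hh.nonerasing A (c u) = L (h.weightVector hh.nonerasing A u) := by
  induction hc with
  | id => exact ⟨LinearMap.id, fun u => rfl⟩
  | node σ ts i c _ ih =>
    obtain ⟨L, hL⟩ := ih
    have key : ∀ q, ∀ r : (h.imageWTAh hh.nonerasing A).rules, ∃ ψ : (Q → K) →ₗ[K] K,
        ∀ u, (h.imageWTAh hh.nonerasing A).ruleWeight (some q)
          (h.apply (.node σ (Function.update ts i u))) r =
            ψ (h.weightVector hh.nonerasing A u) :=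
      fun q r => hh.exists_ruleWeight_update_eq A σ ts i q r.2
    choose ψ hψ using key
    refine ⟨(LinearMap.pi fun q => ∑ r, ψ q r) ∘ₗ L, fun u => ?_⟩
    funext q
    rw [LinearMap.comp_apply, ← hL, LinearMap.pi_apply, LinearMap.sum_apply]
    simp only [← hψ]
    rw [weightVector, WTAh.stateWeight_eq_sum_ruleWeight, ← Finset.sum_coe_sort]

/-- Induction along the path to `p`. If it passes through an occurrence of the `i`-th variable, that
occurrence carries a proper state, so the other occurrences of the variable carry `⊥` and the runs
below them impose no constraints of their own. The class below the proper occurrence is thus copied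
unchanged to all of them, which amounts to one hole in the `i`-th child of the preimage. -/
theorem exists_context_of_at [CommSemiring K] {h : TreeHom rkS rkD} {hne : h.Nonerasing}
    (hnd : h.Nondeleting) {A : WTA rkS Q K} {ρ ρ' : RunTree rkD (Option Q)} {p : List ℕ}
    (hρ : (h.imageWTAh hne A).IsRun ρ) (hp : ρ.At p ρ') (ht : ρ'.rule.target ≠ none) :
    ∃ c, RTree.IsContext c ∧
      ∀ u, ρ.tree.graft {x | ρ.Constrained p x} (h.apply u) = h.apply (c u) := by
  induction hp with
  | root ρ => exact ⟨_, .id, fun u => RTree.graft_of_nil_mem _ (.refl _) _⟩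
  | step r sub o p ρ' hp ih =>
    have hrun := hρ
    simp only [WTAh.IsRun] at hrun
    obtain ⟨hr, hlab, hcon, hsub⟩ := hrun
    obtain ⟨c, hc, hcu⟩ := ih (hsub o) ht
    have ho := target_ne_none_of_at (hsub o) hp ht
    obtain ⟨r, -, rfl⟩ := exists_mapRule_eq hr
      (target_ne_none_of_at hρ (RunTree.at_addr r sub o) ho)
    obtain ⟨ts, hts⟩ := exists_children hnd hρ
    obtain ⟨i, hi⟩ := exists_addr_mem_posOf h hne r o
    rw [hlab] at ho
    refine ⟨_, .node r.sym ts i c hc, fun u => ?_⟩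
    let X : Set (List ℕ) :=
      {x | ∃ o' y, (h.mapRule hne r).lhs.addr o' ∈ (h.img r.sym).posOf i ∧ (sub o).Constrained p y ∧
        x = (h.mapRule hne r).lhs.addr o' ++ y}
    have hX : {x | (RunTree.mk (h.mapRule hne r) sub).Constrained ((h.mapRule hne r).lhs.addr o ++ p) x} =
        X := by
      ext x
      constructor
      · intro hx
        refine (RunTree.Constrained.mem_iff (X := X) ?_ hx).1 ⟨o, p, hi, .refl _, rfl⟩
        rintro p₁ ρ₁ w w' v hp₁ hw ⟨o', y, ho', hy, he⟩
        -- A generator at the root moves between occurrences of one variable and keeps the remainder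
        -- of the position; a generator further down stays below one occurrence `o₁`.
        rcases hp₁ with _ | ⟨_, _, o₁, p₁, _, hp₁⟩
        · obtain ⟨h₂, h₃⟩ := (h.mapRule hne r).constr_subset _ _ hw
          obtain ⟨j, hj, hj'⟩ := hw
          obtain ⟨o₂, rfl⟩ := RTree.exists_occ_of_mem_posVar h₂
          obtain ⟨o₃, rfl⟩ := RTree.exists_occ_of_mem_posVar h₃
          obtain ⟨rfl, rfl⟩ := RTree.addr_append_inj _ he
          obtain rfl := RTree.posOf_unique hj ho'
          exact ⟨o₃, v, hj', hy, rfl⟩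
        · simp only [List.append_assoc] at he ⊢
          obtain ⟨rfl, rfl⟩ := RTree.addr_append_inj _ he
          refine ⟨o₁, _, ho', ?_, rfl⟩
          by_cases hoo : o₁ = o
          · subst hoo
            have := RunTree.constrained_of_constr hp₁ hw v
            simp only [List.append_assoc] at this
            exact hy.trans _ _ _ this
          · have hn := label_eq_none_of_ne hne r hi ho' hoo ho
            rw [← eq_of_mem_constr_of_target_eq_none (hsub o₁) ((hlab o₁).trans hn) hp₁ hw]
            exact hy
      · rintro ⟨o', y, ho', hy, rfl⟩
        -- Move from `p` to `y` below `o`, then pass from `o` to `o'` by the constraint at the root.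
        refine (RunTree.Constrained.append_addr hy).trans _ _ _ ?_
        exact RunTree.constrained_of_constr (p := []) (.root (.mk (h.mapRule hne r) sub))
          ⟨i, hi, ho'⟩ y
    have hXa : ∀ x ∈ X, ∃ o y, x = (h.mapRule hne r).lhs.addr o ++ y := by
      rintro x ⟨o', y, -, -, hx⟩
      exact ⟨o', y, hx⟩
    rw [hX]
    simp only [RunTree.tree]
    rw [RTree.graft_plug _ _ _ hXa]
    refine plug_mapRule h hne r fun o' j hj => ?_
    by_cases hji : j = i
    · subst hji
      rw [Function.update_self, ← hcu, hcon o' o ⟨j, hj, hi⟩]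
      congr 1
      ext x
      constructor
      · rintro ⟨o₁, y, -, hy, he⟩
        obtain ⟨rfl, rfl⟩ := RTree.addr_append_inj _ he
        exact hy
      · exact fun hx => ⟨o', x, hj, hx, rfl⟩
    -- Below occurrences of the other variables nothing is replaced.
    · have hemp : {x | (h.mapRule hne r).lhs.addr o' ++ x ∈ X} = ∅ := by
        refine Set.eq_empty_of_forall_notMem ?_
        rintro x ⟨o₁, y, ho₁, -, he⟩
        obtain ⟨rfl, rfl⟩ := RTree.addr_append_inj _ he
        exact hji (RTree.posOf_unique hj ho₁)
      rw [Function.update_of_ne hji, ← hts o' j hj]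
      exact (congrArg (fun H => (sub o').tree.graft H (h.apply u)) hemp).trans
        (RTree.graft_empty _ _)

/-- A multi-context whose holes form a constraint class is the image of a context with one hole. -/
theorem exists_context_of_isConstraintClass [CommSemiring K] {h : TreeHom rkS rkD}
    {hne : h.Nonerasing} (hnd : h.Nondeleting) {A : WTA rkS Q K} {ρ : RunTree rkD (Option Q)}
    {C : RTree rkD Unit} {t₀ : RTree rkD Empty} (hρ : (h.imageWTAh hne A).IsRun ρ)
    (ht : ρ.tree = C.fill t₀) (hC : ρ.IsConstraintClass C.holes) :
    (∃ u₀, t₀ = h.apply u₀) ∧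
      ∃ c, RTree.IsContext c ∧ ∀ u, C.fill (h.apply u) = h.apply (c u) := by
  obtain ⟨p, ⟨r, sub⟩, w, hp, hr, hw, hholes⟩ := hC
  have hρ' := hp.isRun hρ
  simp only [WTAh.IsRun] at hρ'
  obtain ⟨r, -, rfl⟩ := exists_mapRule_eq hρ'.1 hr
  rw [RunTree.rule, mapRule, RTree.posVar_relabel] at hw
  obtain ⟨i, hi⟩ := hw
  -- The given state position `w` may carry `⊥`. It is exchanged for the occurrence of the same
  -- variable with a proper state, which lies in the same class.
  obtain ⟨o, ho, hl⟩ := exists_occ_label_eq_some hne hnd r i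
  have hsub : (sub o).rule.target ≠ none := by
    rw [hρ'.2.1 o, hl]
    simp
  have hcon : ρ.Constrained (p ++ w) (p ++ (h.mapRule hne r).lhs.addr o) := by
    simpa using RunTree.constrained_of_constr hp (w := w) ⟨i, hi, ho⟩ []
  have hat := hp.trans (RunTree.at_addr _ sub o)
  have hclass : C.holes = {x | ρ.Constrained (p ++ (h.mapRule hne r).lhs.addr o) x} := by
    rw [hholes]
    ext x
    exact ⟨fun hx => (hcon.symm).trans _ _ _ hx, fun hx => hcon.trans _ _ _ hx⟩
  constructor
  · obtain ⟨u₀, hu₀⟩ := exists_apply_eq_tree hnd (hρ'.2.2.2 o) hsub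
    refine ⟨u₀, ?_⟩
    rw [← hu₀]
    have h1 := C.subtreeAt_hole t₀ (p := p ++ (h.mapRule hne r).lhs.addr o)
      (by rw [hholes]; exact hcon)
    rw [← ht, hat.subtreeAt_tree] at h1
    exact (Option.some_injective _ h1).symm
  · obtain ⟨c, hc, hcu⟩ := exists_context_of_at hnd hρ hat hsub
    refine ⟨c, hc, fun u => ?_⟩
    rw [← hcu, ← hclass, ht]
    exact C.fill_eq_graft _ _

theorem TetrisFree.exists_series_context_eq [CommSemiring K] {h : TreeHom rkS rkD}
    (hh : h.TetrisFree) (A : WTA rkS Q K) {c : RTree rkS Empty → RTree rkS Empty}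
    (hc : RTree.IsContext c) : ∃ φ : (Q → K) →ₗ[K] K,
      ∀ u, (h.imageWTAh hh.nonerasing A).series (h.apply (c u)) =
        φ (h.weightVector hh.nonerasing A u) := by
  classical
  obtain ⟨L, hL⟩ := hh.exists_stateWeight_context_eq A hc
  refine ⟨∑ q ∈ A.final, LinearMap.proj q ∘ₗ L, fun u => ?_⟩
  simp only [LinearMap.sum_apply, LinearMap.comp_apply, ← hL, LinearMap.proj_apply]
  rw [WTAh.series, imageWTAh, Finset.sum_image fun _ _ _ _ e => Option.some_injective _ e]
  rfl

end TreeHom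

/-! ### Descending chains of spans and the conclusion -/

/-- Let `v` be a family of vectors in an Artinian module whose indices have degrees `d`. There is `N`
such that every linear functional that does not vanish at some `v u` with `N ≤ d u` does not vanish
at some `v u` with arbitrarily large `d u`. -/
theorem exists_forall_exists_le_apply_ne_zero {K V U : Type*} [CommRing K] [AddCommGroup V]
    [Module K V] [IsArtinian K V] (v : U → V) (d : U → ℕ) :
    ∃ N, ∀ φ : V →ₗ[K] K, ∀ u₀, N ≤ d u₀ → φ (v u₀) ≠ 0 → ∀ n, ∃ u, n ≤ d u ∧ φ (v u) ≠ 0 := by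
  let F : ℕ →o (Submodule K V)ᵒᵈ :=
    ⟨fun n => OrderDual.toDual (Submodule.span K (v '' {u | n ≤ d u})), fun m n hmn =>
      Submodule.span_mono (Set.image_mono fun u (hu : n ≤ d u) => hmn.trans hu)⟩
  obtain ⟨N, hN⟩ := IsArtinian.monotone_stabilizes F
  refine ⟨N, fun φ u₀ hu₀ hφ n => ?_⟩
  by_contra! hcon
  -- The chain is known to be constant only from `N` on, hence the comparison with `max N n`.
  have h1 : Submodule.span K (v '' {u | N ≤ d u}) = Submodule.span K (v '' {u | max N n ≤ d u}) :=
    hN (max N n) (le_max_left _ _)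
  have h2 : Submodule.span K (v '' {u | max N n ≤ d u}) ≤ LinearMap.ker φ := by
    rw [Submodule.span_le]
    rintro _ ⟨u, hu, rfl⟩
    exact hcon u ((le_max_right _ _).trans hu)
  exact hφ (h2 (h1 ▸ Submodule.subset_span ⟨u₀, hu₀, rfl⟩))

theorem mainTheorem4 {S D Q K : Type*} [Fintype S] [Fintype D] [Fintype Q] [Field K]
    (rkS : S → ℕ) (rkD : D → ℕ) (A : WTA rkS Q K) (h : TreeHom rkS rkD) (hh : h.TetrisFree) :
    ∃ N : ℕ, ∀ (C : RTree rkD Unit) (t₀ : RTree rkD Empty), C.IsMultiContext →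
      (h.imageWTAh hh.nonerasing A).series (C.fill t₀) ≠ 0 →
      N ≤ t₀.height →
      (∃ q, ∃ ρ ∈ (h.imageWTAh hh.nonerasing A).runs (C.fill t₀) q,
        ρ.IsConstraintClass C.holes) →
      ∃ t : ℕ → RTree rkD Empty, Function.Injective t ∧
        ∀ i, (h.imageWTAh hh.nonerasing A).series (C.fill (t i)) ≠ 0 := by
  obtain ⟨N, hN⟩ := exists_forall_exists_le_apply_ne_zero (K := K)
    (h.weightVector hh.nonerasing A) fun u => (h.apply u).height
  refine ⟨N, fun C t₀ _ hne hheight ⟨q, ρ, hρ, hC⟩ => ?_⟩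
  obtain ⟨⟨u₀, rfl⟩, c, hc, hcu⟩ :=
    TreeHom.exists_context_of_isConstraintClass hh.nondeleting hρ.1 hρ.2.1 hC
  obtain ⟨φ, hφ⟩ := hh.exists_series_context_eq A hc
  rw [hcu, hφ] at hne
  let T : Set (RTree rkD Empty) :=
    {t | (h.imageWTAh hh.nonerasing A).series (C.fill t) ≠ 0}
  have hT : T.Infinite := by
    -- Unbounded heights of the trees `h u` already give infinitely many trees, so distinctness need
    -- not be traced back to `u`.
    refine Set.Infinite.of_image RTree.height (Set.infinite_of_not_bddAbove ?_)
    rintro ⟨b, hb⟩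
    obtain ⟨u, hu, hu0⟩ := hN φ u₀ hheight hne (b + 1)
    have := hb ⟨h.apply u, by simpa only [T, Set.mem_ofPred_eq, hcu, hφ] using hu0, rfl⟩
    omega
  exact ⟨fun n => hT.natEmbedding T n, fun m n e => (hT.natEmbedding T).injective (Subtype.ext e),
    fun n => (hT.natEmbedding T n).2⟩
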